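/- **Lemma.** $\mathrm{QPCP}[O(1)]\subseteq \mathrm{FermPCP}[O(1)]$, where $\mathrm{QPCP}[O(1)]=\bigcup_{q\in\mathbb N}\mathrm{QPCP}[q]$ and $\mathrm{FermPCP}[O(1)]=\bigcup_{q\in\mathbb N}\mathrm{FermPCP}[q]$ are the following classes of promise problems. More precisely, the inclusion holds for every set $R$ of functions $\mathbb N\to\mathbb N$, if in both classes the number of random bits of the verifier, as a function of the input length, is required to belong to $R$ (for instance $R$ all functions, or all functions bounded by a polynomial in $\log n$). *Promise problems.* A promise problem consists of two disjoint sets $L_{\rm yes},L_{\rm no}\subseteq\{0,1\}^*$. *Verifiers.* A verifier with access to $q$ positions has a polynomial $p$ (the size of the proof), a polynomial $a$ (the number of ancilla qubits is $a(n)+1$), and a number $r(n)$ of random bits, where $1^n\mapsto 1^{r(n)}$ is computable in polynomial time. Given $x\in\{0,1\}^n$ and uniformly random bits $s\in\{0,1\}^{r(n)}$, it computes from $(x,s)$ in deterministic polynomial time (on a Turing machine) $q$ distinct positions in $\{0,\dots,p(n)-1\}$ and the description of a quantum circuit. The circuit is run on the proof and on the $a(n)+1$ ancilla qubits, initially in the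 state $|0\cdots0\rangle$, and acts on the proof only at the $q$ chosen positions. Finally ancilla qubit $0$ is measured in the $Z$-basis, and the verifier accepts if the outcome is $1$. The acceptance probability is averaged over $s$. *Qubit verifiers.* The proof is a density matrix $\rho$ on $p(|x|)$ qubits. The gates are $\exp(\pm i\frac{\pi}{8}P)$, where $P$ is a tensor product of Pauli matrices on at most two qubits, each a chosen proof qubit or an ancilla qubit. (Up to global phases these gates generate all Clifford gates and the $T$ gate.) *Fermionic verifiers.* The proof is a state $\rho_f$ of $p(|x|)$ fermionic modes, that is, a density matrix on Fock space that is an even polynomial in the Majorana operators $c_1,\dots,c_{2p(|x|)}$. The gates are $\exp(\pm i\frac{\pi}{8}\,C_K\otimes P)$, where $K$ is a set of even size of the $2q$ Majorana operators of the chosen modes, $C_K=i^{|K|(|K|-1)/2}\prod_{k\in K}c_k$ (ordered product), $P$ is a tensor product of Pauli matrices on $w\le 2$ ancilla qubits, and $|K|+2w\le4$. *The classes.* A promise problem $(L_{\rm yes},L_{\rm no})$ is in $\mathrm{QPCP}[q]$ if there is a qubit verifier with access to $q$ qubits such that - for every $x\in L_{\rm yes}$ there is a density matrix $\rho$ that is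 accepted with probability at least $2/3$; - for every $x\in L_{\rm no}$, every density matrix $\rho$ is accepted with probability at most $1/3$. It is in $\mathrm{FermPCP}[q]$ if there is a fermionic verifier with access to $q$ modes with the same two properties for fermionic states $\rho_f$ in place of $\rho$. -/

import Mathlib

open scoped Kronecker ComplexOrder

namespace FermionicPCP

/-! ### Promise problems -/

/-- A promise problem over binary strings. -/
structure PromiseProblem where
  yes : Set (List Bool)
  no : Set (List Bool)
  disjoint : Disjoint yes no

/-! ### Operators on qubits and on fermionic modes

`Fin n → Bool` indexes the computational basis of `n` qubits, and also the occupation number basis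
of the Fock space of `n` fermionic modes. -/

/-- Operators on `(ℂ²)^{⊗ n}`. -/
abbrev Op (n : ℕ) : Type := Matrix (Fin n → Bool) (Fin n → Bool) ℂ

/-- The tensor product `A 0 ⊗ ⋯ ⊗ A (n - 1)` of one-qubit operators. -/
def tensor {n : ℕ} (A : Fin n → Matrix Bool Bool ℂ) : Op n :=
  Matrix.of fun s t => ∏ k, A k (s k) (t k)

/-- The labels of the four one-qubit Pauli matrices. -/
inductive Pauli
  | I
  | X
  | Y
  | Z
  deriving DecidableEq

instance : Fintype Pauli := ⟨{Pauli.I, Pauli.X, Pauli.Y, Pauli.Z}, by intro P; cases P <;> decide⟩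

/-- The Pauli matrices; `false` labels `|0⟩` and `true` labels `|1⟩`. -/
noncomputable def Pauli.toMatrix : Pauli → Matrix Bool Bool ℂ
  | Pauli.I => 1
  | Pauli.X => Matrix.of fun s t => if s = t then 0 else 1
  | Pauli.Y => Matrix.of fun s t => if s = t then 0 else if s then Complex.I else -Complex.I
  | Pauli.Z => Matrix.of fun s t => if s = t then (if s then -1 else 1) else 0

/-- The tensor product of Pauli matrices with the given labels. -/
noncomputable def pauliString {n : ℕ} (P : Fin n → Pauli) : Op n :=
  tensor fun k => (P k).toMatrix

/-- The two Majorana operators (`s = 0, 1`) of mode `j` among `n` fermionic modes, on Fock space in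
the occupation number basis: `Z ⊗ ⋯ ⊗ Z ⊗ X ⊗ 1 ⊗ ⋯ ⊗ 1` and `Z ⊗ ⋯ ⊗ Z ⊗ Y ⊗ 1 ⊗ ⋯ ⊗ 1`, with the
`X` or `Y` at position `j`. -/
noncomputable def majorana (n : ℕ) (j : ℕ) (s : Fin 2) : Op n :=
  pauliString fun k : Fin n =>
    if (k : ℕ) < j then Pauli.Z
    else if (k : ℕ) = j then (if s = 0 then Pauli.X else Pauli.Y)
    else Pauli.I

/-- The fermionic parity operator. -/
noncomputable def parity (n : ℕ) : Op n := pauliString fun _ => Pauli.Z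

/-- Density matrices. -/
def IsDensity {ι : Type} [Fintype ι] (ρ : Matrix ι ι ℂ) : Prop :=
  ρ.PosSemidef ∧ ρ.trace = 1

/-- Fermionic states: density matrices that are even polynomials in the Majorana operators, that
is, commute with the parity operator. -/
def IsFermionicState {n : ℕ} (ρ : Op n) : Prop :=
  IsDensity ρ ∧ Commute (parity n) ρ

/-! ### Gates and circuits

The gates are the rotations `exp(± i (π/8) P)`, where `P` is a Hermitian product of elementary
operators (Pauli or Majorana) of bounded weight. A gate acts on the accessed part of the proof
through a label in a finite type `G`, and on at most two ancilla qubits. On qubits, the rotations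
with Pauli strings of weight at most two generate, up to global phases, all Clifford gates and the
`T` gate. -/

/-- The description of a gate. -/
structure Gate (G : Type) where
  /-- the sign of the rotation angle: `true` for `-π/8`, `false` for `π/8` -/
  neg : Bool
  /-- the action on the accessed part of the proof -/
  onProof : G
  /-- the Pauli matrix that acts on the first ancilla -/
  pauli₁ : Pauli
  /-- the Pauli matrix that acts on the second ancilla -/
  pauli₂ : Pauli
  /-- the number of the first ancilla -/
  anc₁ : ℕ
  /-- the number of the second ancilla -/
  anc₂ : ℕ

/-- The number of ancillas on which a gate acts with a nontrivial Pauli matrix. -/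
def Gate.ancWeight {G : Type} (g : Gate G) : ℕ :=
  (if g.pauli₁ = Pauli.I then 0 else 1) + (if g.pauli₂ = Pauli.I then 0 else 1)

/-- The Pauli string of a gate on `a` ancilla qubits. -/
noncomputable def Gate.ancOp {G : Type} (a : ℕ) (g : Gate G) : Op a :=
  pauliString fun k : Fin a =>
    if (k : ℕ) = g.anc₁ then g.pauli₁ else if (k : ℕ) = g.anc₂ then g.pauli₂ else Pauli.I

/-- The unitary of a gate on a proof register of dimension `2 ^ n` and `a` ancilla qubits, where
`L l` is the Hermitian involution on the proof register with the label `l`. Since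
`P = L l ⊗ ancOp` squares to `1`, this is `exp(± i (π/8) P)`. -/
noncomputable def Gate.op {G : Type} {n : ℕ} (L : G → Op n) (a : ℕ) (g : Gate G) :
    Matrix ((Fin n → Bool) × (Fin a → Bool)) ((Fin n → Bool) × (Fin a → Bool)) ℂ :=
  (Real.cos (Real.pi / 8) : ℂ) • 1 +
    ((if g.neg then -1 else 1) * Complex.I * (Real.sin (Real.pi / 8) : ℂ)) •
      (L g.onProof ⊗ₖ g.ancOp a)

/-- The unitary of a circuit; the gate at the head of the list is applied first. -/
noncomputable def circuitOp {G : Type} {n : ℕ} (L : G → Op n) (a : ℕ) :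
    List (Gate G) →
      Matrix ((Fin n → Bool) × (Fin a → Bool)) ((Fin n → Bool) × (Fin a → Bool)) ℂ
  | [] => 1
  | g :: c => circuitOp L a c * g.op L a

/-- The state `|0⋯0⟩⟨0⋯0|` of `a` ancilla qubits. -/
noncomputable def zeroState (a : ℕ) : Op a :=
  Matrix.single (fun _ => false) (fun _ => false) 1

/-- The projector onto the outcome `1` of a measurement of ancilla `0` in the `Z`-basis. -/
noncomputable def acceptProj (n a : ℕ) :
    Matrix ((Fin n → Bool) × (Fin (a + 1) → Bool)) ((Fin n → Bool) × (Fin (a + 1) → Bool)) ℂ :=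
  Matrix.diagonal fun s => if s.2 0 then 1 else 0

/-- The probability that a circuit accepts the proof `ρ`: it is run on `ρ` and `a + 1` ancillas in
the state `|0⋯0⟩`, and then ancilla `0` is measured in the `Z`-basis. -/
noncomputable def circuitAccept {G : Type} {n : ℕ} (L : G → Op n) (a : ℕ) (c : List (Gate G))
    (ρ : Op n) : ℝ :=
  (Matrix.trace (acceptProj n a *
    (circuitOp L (a + 1) c * (ρ ⊗ₖ zeroState (a + 1)) * (circuitOp L (a + 1) c).conjTranspose))).re

/-! ### Qubit gates -/

/-- The action of a gate on `q` accessed qubits: a Pauli matrix for each of them. -/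
abbrev QubitLabel (q : ℕ) : Type := Fin q → Pauli

/-- The Pauli string on `p` qubits whose factor at the accessed position `pos i` is `P i`. -/
noncomputable def qubitLabelOp {q : ℕ} (p : ℕ) (pos : Fin q → ℕ) (P : QubitLabel q) : Op p :=
  pauliString fun k : Fin p => Function.extend pos P (fun _ => Pauli.I) (k : ℕ)

/-- The gates of qubit verifiers act on at most two qubits. -/
def IsQubitGate {q : ℕ} (g : Gate (QubitLabel q)) : Prop :=
  (Finset.univ.filter fun i => g.onProof i ≠ Pauli.I).card + g.ancWeight ≤ 2

/-! ### Fermionic gates -/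

/-- The action of a gate on `q` accessed modes: a subset of their `2 q` Majorana operators. The
operator with the number `k` is Majorana operator `k % 2` of the accessed mode `k / 2`. -/
abbrev FermionLabel (q : ℕ) : Type := Finset (Fin (q * 2))

/-- The Hermitian operator `C_K = i^{|K|(|K|-1)/2} c_{k₁} ⋯ c_{k_r}` on `p` modes, with
`K = {k₁ < ⋯ < k_r}` a set of Majorana operators of the modes at the accessed positions. -/
noncomputable def fermionLabelOp {q : ℕ} (p : ℕ) (pos : Fin q → ℕ) (K : FermionLabel q) : Op p :=
  Complex.I ^ (K.card * (K.card - 1) / 2) •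
    ((List.finRange (q * 2)).map fun k =>
      if k ∈ K then majorana p (pos k.divNat) k.modNat else 1).prod

/-- The gates of fermionic verifiers are even in the Majorana operators, and act on at most four
Majorana operators, or two of them and one ancilla qubit, or two ancilla qubits. -/
def IsFermionGate {q : ℕ} (g : Gate (FermionLabel q)) : Prop :=
  Even g.onProof.card ∧ g.onProof.card + 2 * g.ancWeight ≤ 4

/-! ### Polynomial-time verifiers -/

/-- The alphabet in which circuits are written. -/
abbrev GateSymbol (G : Type) : Type := (Bool × G × Pauli × Pauli) ⊕ Bool

/-- A gate is written as one symbol for its kind, followed by the numbers of the two ancillas in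
unary, with different marks. -/
def encodeGate {G : Type} (g : Gate G) : List (GateSymbol G) :=
  Sum.inl (g.neg, g.onProof, g.pauli₁, g.pauli₂) ::
    (List.replicate g.anc₁ (Sum.inr false) ++ List.replicate g.anc₂ (Sum.inr true))

/-- A circuit is written gate by gate. -/
def encodeCircuit {G : Type} (c : List (Gate G)) : List (GateSymbol G) :=
  c.flatMap encodeGate

/-- The encoding of the input `x` and the random string `r` of a verifier. -/
def encodeInput : List Bool × List Bool → List (Bool ⊕ Bool) :=
  (Computability.encodingProd (Computability.encodingList Bool)
    (Computability.encodingList Bool)).encode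

/-- The function `f` is computed by a Turing machine in polynomial time. -/
def PolyTime {α β αΓ βΓ : Type} (ea : α → List αΓ) (eb : β → List βΓ) (f : α → β) : Prop :=
  Nonempty (Turing.TM2ComputableInPolyTime ea eb f)

/-- A polynomial-time verifier that has access to `q` positions of its proof. On input `x` with
random bits `r`, it computes in polynomial time the positions that it accesses and the circuit that
it runs, with labels in `G` for the action on the accessed part of the proof. The gates in the
circuit must satisfy `IsGate`. -/
structure Verifier (q : ℕ) (G : Type) (IsGate : Gate G → Prop) where
  /-- the number of qubits or modes of the proof, as a function of `|x|` -/
  proofSize : Polynomial ℕ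
  /-- the number of ancillas in addition to the output ancilla `0`, as a function of `|x|` -/
  ancillas : Polynomial ℕ
  /-- the number of random bits, as a function of `|x|` -/
  randomBits : ℕ → ℕ
  randomBits_poly :
    PolyTime Computability.unaryEncodeNat Computability.unaryEncodeNat randomBits
  /-- the accessed positions -/
  position : Fin q → List Bool × List Bool → ℕ
  position_poly : ∀ i, PolyTime encodeInput Computability.encodeNat (position i)
  position_lt : ∀ x r : List Bool, r.length = randomBits x.length →
    ∀ i, position i (x, r) < proofSize.eval x.length
  position_injective : ∀ x r : List Bool, r.length = randomBits x.length →
    Function.Injective fun i => position i (x, r)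
  /-- the circuit -/
  circuit : List Bool × List Bool → List (Gate G)
  circuit_poly : PolyTime encodeInput encodeCircuit circuit
  circuit_isGate : ∀ x r : List Bool, r.length = randomBits x.length →
    ∀ g ∈ circuit (x, r), IsGate g ∧
      g.anc₁ ≤ ancillas.eval x.length ∧ g.anc₂ ≤ ancillas.eval x.length

/-- Polynomial-time verifiers that access `q` qubits of a qubit proof. -/
abbrev QubitVerifier (q : ℕ) : Type := Verifier q (QubitLabel q) IsQubitGate

/-- Polynomial-time verifiers that access `q` modes of a fermionic proof. -/
abbrev FermionVerifier (q : ℕ) : Type := Verifier q (FermionLabel q) IsFermionGate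

/-- The probability that a verifier accepts the proof `ρ` on input `x`, for uniformly random bits;
`L p pos l` is the operator on the proof with the label `l`, if the positions `pos` of the proof,
which has size `p`, are accessed. -/
noncomputable def Verifier.acceptProb {q : ℕ} {G : Type} {IsGate : Gate G → Prop}
    (V : Verifier q G IsGate) (L : (p : ℕ) → (Fin q → ℕ) → G → Op p) (x : List Bool)
    (ρ : Op (V.proofSize.eval x.length)) : ℝ :=
  (∑ r : Fin (V.randomBits x.length) → Bool,
    circuitAccept
      (L (V.proofSize.eval x.length) fun i => V.position i (x, List.ofFn r))
      (V.ancillas.eval x.length) (V.circuit (x, List.ofFn r)) ρ) /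
    2 ^ V.randomBits x.length

/-! ### The classes -/

/-- The class `QPCP[q]`, for verifiers whose number of random bits, as a function of the input
length, belongs to `R`. -/
def QPCP (R : Set (ℕ → ℕ)) (q : ℕ) : Set PromiseProblem :=
  {A | ∃ V : QubitVerifier q, V.randomBits ∈ R ∧
    (∀ x ∈ A.yes, ∃ ρ : Op (V.proofSize.eval x.length),
      IsDensity ρ ∧ 2 / 3 ≤ V.acceptProb qubitLabelOp x ρ) ∧
    (∀ x ∈ A.no, ∀ ρ : Op (V.proofSize.eval x.length),
      IsDensity ρ → V.acceptProb qubitLabelOp x ρ ≤ 1 / 3)}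

/-- The class `FermPCP[q]`, for verifiers whose number of random bits, as a function of the input
length, belongs to `R`. -/
def FermPCP (R : Set (ℕ → ℕ)) (q : ℕ) : Set PromiseProblem :=
  {A | ∃ V : FermionVerifier q, V.randomBits ∈ R ∧
    (∀ x ∈ A.yes, ∃ ρ : Op (V.proofSize.eval x.length),
      IsFermionicState ρ ∧ 2 / 3 ≤ V.acceptProb fermionLabelOp x ρ) ∧
    (∀ x ∈ A.no, ∀ ρ : Op (V.proofSize.eval x.length),
      IsFermionicState ρ → V.acceptProb fermionLabelOp x ρ ≤ 1 / 3)}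

/-- The class `QPCP[O(1)]`. -/
def QPCPConst (R : Set (ℕ → ℕ)) : Set PromiseProblem := ⋃ q : ℕ, QPCP R q

/-- The class `FermPCP[O(1)]`. -/
def FermPCPConst (R : Set (ℕ → ℕ)) : Set PromiseProblem := ⋃ q : ℕ, FermPCP R q

end FermionicPCP

namespace FermionicPCP

/-! ### Polynomial-time computability -/

/-! Each qubit is stored in four fermionic modes, and the qubit verifier is run gate by gate on the
stored qubits. For three distinct Majorana operators `a`, `b`, `c`, the even operators `i a b`, `i a
c`, `i c b` satisfy the Pauli relations, up to fixed signs. With `a`, `c`, `b` the operators `(3,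
0)`, `(2, 0)`, `(2, 1)` of a block, they are the logical `X`, `Y`, `Z`. Being even, they commute
with those of other blocks, and the Jordan-Wigner strings between blocks cancel.

This is a subsystem encoding: Fock space is, after relabelling the basis, (logical qubits) ⊗
(gauge), and every simulated gate acts as the identity on the gauge factor
(`fermionLabelOp_encodeLabel`). So any state of the modes is accepted with exactly the probability
of its partial trace over the gauge (`circuitAccept_map_mapLabel`). No code space has to be tested:
soundness follows by tracing out the gauge, completeness by putting the gauge into a basis state,
which makes the state even. A weight-`m` Pauli string becomes one Majorana product of size `2m`, so
circuits keep their length and `q` becomes `2q`.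

Polynomial time needs only two modifications of a Turing machine: pushing fixed symbols on its
output (`PolyTime.cons`) and renaming the output symbols injectively (`PolyTime.mapAlphabet`).
Blocks of four, with only modes 2 and 3 used, make the first suffice: in binary, least significant
bit first, `4n + 3` and `4n + 2` are `n` with two fixed bits in front, also for `n = 0`. -/

theorem encodeNat_two_mul_add_one (n : ℕ) :
    Computability.encodeNat (2 * n + 1) = true :: Computability.encodeNat n := by
  have h : ((2 * n + 1 : ℕ) : Num) = Num.bit1 (n : Num) := by
    apply Num.to_nat_inj.1
    simp [Num.bit1_of_bit1, two_mul]
  rw [Computability.encodeNat, Computability.encodeNat, h]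
  cases (n : Num) <;> rfl

/-- Zero is excluded because its code is the empty list. -/
theorem encodeNat_two_mul {n : ℕ} (hn : n ≠ 0) :
    Computability.encodeNat (2 * n) = false :: Computability.encodeNat n := by
  have h : ((2 * n : ℕ) : Num) = Num.bit0 (n : Num) := by
    apply Num.to_nat_inj.1
    simp [Num.bit0_of_bit0, two_mul]
  rw [Computability.encodeNat, Computability.encodeNat, h]
  cases hm : (n : Num) with
  | zero => exact absurd (by simpa using congrArg (fun m : Num => (m : ℕ)) hm) hn
  | pos m => rfl

/-- A map that intertwines two step functions intertwines their iterates. -/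
theorem iterate_bind_map {σ τ : Type} {f : σ → Option σ} {g : τ → Option τ} {φ : σ → τ}
    (h : ∀ c, g (φ c) = (f c).map φ) (n : ℕ) (c : Option σ) :
    (flip bind g)^[n] (c.map φ) = ((flip bind f)^[n] c).map φ := by
  induction n generalizing c with
  | zero => rfl
  | succ n ih =>
    rw [Function.iterate_succ_apply, Function.iterate_succ_apply, ← ih]
    congr 1
    cases c with
    | none => rfl
    | some c => exact h c

/-- Simulation of an evaluation along a map that intertwines the step functions. -/
def evalsToInTimeMap {σ τ : Type} {f : σ → Option σ} {g : τ → Option τ} (φ : σ → τ)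
    (h : ∀ c, g (φ c) = (f c).map φ) {a : σ} {b : Option σ} {m : ℕ}
    (e : StateTransition.EvalsToInTime f a b m) {a' : τ} (ha : a' = φ a) {b' : Option τ}
    (hb : b' = b.map φ) : StateTransition.EvalsToInTime g a' b' m where
  steps := e.steps
  evals_in_steps := by
    rw [hb, ha]
    exact (iterate_bind_map h e.steps (some a)).trans
      (congrArg (Option.map φ) e.evals_in_steps)
  steps_le_m := e.steps_le_m

/-! ### Pushing a symbol on the output stack of a machine -/

section PushOnHalt

variable {K : Type} {Γ : K → Type} {Λ σ : Type}

/-- The statement that pushes `b` on the stack `k` before halting. -/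
def pushOnHalt (k : K) (b : Γ k) : Turing.TM2.Stmt Γ Λ σ → Turing.TM2.Stmt Γ Λ σ
  | .push j f s => .push j f (pushOnHalt k b s)
  | .peek j f s => .peek j f (pushOnHalt k b s)
  | .pop j f s => .pop j f (pushOnHalt k b s)
  | .load f s => .load f (pushOnHalt k b s)
  | .branch f s t => .branch f (pushOnHalt k b s) (pushOnHalt k b t)
  | .goto f => .goto f
  | .halt => .push k (fun _ => b) .halt

/-- Push `b` on the stack `k` of halted configurations. -/
def pushIfHalted [DecidableEq K] (k : K) (b : Γ k) (c : Turing.TM2.Cfg Γ Λ σ) :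
    Turing.TM2.Cfg Γ Λ σ :=
  if c.l.isNone then ⟨c.l, c.var, Function.update c.stk k (b :: c.stk k)⟩ else c

theorem stepAux_pushOnHalt [DecidableEq K] (k : K) (b : Γ k) (s : Turing.TM2.Stmt Γ Λ σ)
    (v : σ) (S : ∀ k, List (Γ k)) :
    Turing.TM2.stepAux (pushOnHalt k b s) v S = pushIfHalted k b (Turing.TM2.stepAux s v S) := by
  induction s generalizing v S with
  | push j f s ih => exact ih _ _
  | peek j f s ih => exact ih _ _
  | pop j f s ih => exact ih _ _
  | load f s ih => exact ih _ _
  | branch f s t ih₁ ih₂ =>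
    simp only [pushOnHalt, Turing.TM2.stepAux]
    cases f v
    · exact ih₂ _ _
    · exact ih₁ _ _
  | goto f => rfl
  | halt => rfl

/-- `pushIfHalted` changes only halted configurations, which have no successor. The additional push
belongs to the statement that halts, so it costs no step. -/
theorem step_pushOnHalt [DecidableEq K] (k : K) (b : Γ k) (m : Λ → Turing.TM2.Stmt Γ Λ σ)
    (c : Turing.TM2.Cfg Γ Λ σ) :
    Turing.TM2.step (fun l => pushOnHalt k b (m l)) (pushIfHalted k b c) =
      (Turing.TM2.step m c).map (pushIfHalted k b) := by
  obtain ⟨l, v, S⟩ := c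
  cases l with
  | none => rfl
  | some l => exact congrArg some (stepAux_pushOnHalt k b (m l) v S)

end PushOnHalt

/-- The head of the output list is the top of the output stack, so one last push prepends `b`; the
time bound is unchanged. -/
theorem PolyTime.cons {α β β' αΓ βΓ : Type} {ea : α → List αΓ} {eb : β → List βΓ}
    {eb' : β' → List βΓ} {f : α → β} {f' : α → β'} (hf : PolyTime ea eb f) (b : βΓ)
    (h : ∀ a, eb' (f' a) = b :: eb (f a)) : PolyTime ea eb' f' := by
  obtain ⟨M⟩ := hf
  let b' := M.outputAlphabet.symm b
  let tm' : Turing.FinTM2 :=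
    { M.tm with m := fun l => pushOnHalt M.tm.k₁ b' (M.tm.m l) }
  refine ⟨⟨⟨tm', M.inputAlphabet, M.outputAlphabet⟩, M.time, fun a => ?_⟩⟩
  refine evalsToInTimeMap (pushIfHalted M.tm.k₁ b')
    (step_pushOnHalt M.tm.k₁ b' M.tm.m) (M.outputsFun a) rfl ?_
  rw [h]
  simp only [Option.map_some, Turing.haltList]
  congr 2
  funext k
  by_cases hk : k = M.tm.k₁
  · subst hk
    simp [b', tm']
  · simp [hk, tm']

/-! ### Enlarging the alphabet of the output stack -/

section ExtendAlphabet

variable {K : Type} {Γ : K → Type} {Λ σ : Type}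

/-- The alphabet `Γ`, enlarged by `E` on the stack `k₁`. -/
abbrev ExtendedAlphabet (Γ : K → Type) (k₁ : K) (E : Type) (k : K) : Type :=
  Γ k ⊕ {_e : E // k = k₁}

/-- A statement, considered over an enlarged alphabet. -/
def extendAlphabet (k₁ : K) (E : Type) :
    Turing.TM2.Stmt Γ Λ σ → Turing.TM2.Stmt (ExtendedAlphabet Γ k₁ E) Λ σ
  | .push j f s => .push j (fun v => Sum.inl (f v)) (extendAlphabet k₁ E s)
  | .peek j f s => .peek j (fun v a => f v (a.bind Sum.getLeft?)) (extendAlphabet k₁ E s)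
  | .pop j f s => .pop j (fun v a => f v (a.bind Sum.getLeft?)) (extendAlphabet k₁ E s)
  | .load f s => .load f (extendAlphabet k₁ E s)
  | .branch f s t => .branch f (extendAlphabet k₁ E s) (extendAlphabet k₁ E t)
  | .goto f => .goto f
  | .halt => .halt

/-- A configuration, considered over an enlarged alphabet. -/
def extendCfg (k₁ : K) (E : Type) (c : Turing.TM2.Cfg Γ Λ σ) :
    Turing.TM2.Cfg (ExtendedAlphabet Γ k₁ E) Λ σ :=
  ⟨c.l, c.var, fun k => (c.stk k).map Sum.inl⟩

theorem head?_map_inl_bind {A B : Type} (l : List A) :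
    ((l.map (Sum.inl : A → A ⊕ B)).head?).bind Sum.getLeft? = l.head? := by
  cases l <;> rfl

theorem stepAux_extendAlphabet [DecidableEq K] (k₁ : K) (E : Type) (s : Turing.TM2.Stmt Γ Λ σ)
    (v : σ) (S : ∀ k, List (Γ k)) :
    Turing.TM2.stepAux (extendAlphabet k₁ E s) v (fun k => (S k).map Sum.inl) =
      extendCfg k₁ E (Turing.TM2.stepAux s v S) := by
  induction s generalizing v S with
  | push j f s ih =>
    simp only [extendAlphabet, Turing.TM2.stepAux, ← ih]
    congr 1
    funext k
    by_cases hk : k = j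
    · subst hk; simp
    · simp [hk]
  | peek j f s ih =>
    simp only [extendAlphabet, Turing.TM2.stepAux, ← ih, head?_map_inl_bind]
  | pop j f s ih =>
    simp only [extendAlphabet, Turing.TM2.stepAux, ← ih, head?_map_inl_bind]
    congr 1
    funext k
    by_cases hk : k = j
    · subst hk; simp
    · simp [hk]
  | load f s ih => exact ih _ _
  | branch f s t ih₁ ih₂ =>
    simp only [extendAlphabet, Turing.TM2.stepAux]
    cases f v
    · exact ih₂ _ _
    · exact ih₁ _ _
  | goto f => rfl
  | halt => rfl

/-- The new symbols never occur on the stacks of an `extendCfg`, so the value `none` with which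
reading treats them is immaterial. -/
theorem step_extendAlphabet [DecidableEq K] (k₁ : K) (E : Type)
    (m : Λ → Turing.TM2.Stmt Γ Λ σ) (c : Turing.TM2.Cfg Γ Λ σ) :
    Turing.TM2.step (fun l => extendAlphabet k₁ E (m l)) (extendCfg k₁ E c) =
      (Turing.TM2.step m c).map (extendCfg k₁ E) := by
  obtain ⟨l, v, S⟩ := c
  cases l with
  | none => rfl
  | some l => exact congrArg some (stepAux_extendAlphabet k₁ E (m l) v S)

end ExtendAlphabet

/-- Injective renaming of the symbols of the output. The input and output alphabets are assumed to
be of different sizes, so that the input and the output are on different stacks. -/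
theorem PolyTime.mapAlphabet {α β β' αΓ βΓ βΓ' : Type} {ea : α → List αΓ} {eb : β → List βΓ}
    {eb' : β' → List βΓ'} {f : α → β} {f' : α → β'} (hf : PolyTime ea eb f)
    (hαβ : IsEmpty (αΓ ≃ βΓ)) {h : βΓ → βΓ'} (hinj : Function.Injective h)
    (hmap : ∀ a, eb' (f' a) = (eb (f a)).map h) : PolyTime ea eb' f' := by
  classical
  obtain ⟨M⟩ := hf
  have hk : M.tm.k₀ ≠ M.tm.k₁ := fun hk =>
    hαβ.false (M.inputAlphabet.symm.trans ((Equiv.cast (congrArg M.tm.Γ hk)).trans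
      M.outputAlphabet))
  -- The output stack alphabet must be in bijection with all of `βΓ'`, so the symbols outside the
  -- range of `h` are added to it. The input stack, being different, receives none.
  let E : Type := ↥(Set.range h)ᶜ
  have : IsEmpty {_e : E // M.tm.k₀ = M.tm.k₁} := ⟨fun e => hk e.2⟩
  let hin : ExtendedAlphabet M.tm.Γ M.tm.k₁ E M.tm.k₀ ≃ M.tm.Γ M.tm.k₀ := Equiv.sumEmpty _ _
  let hout : ExtendedAlphabet M.tm.Γ M.tm.k₁ E M.tm.k₁ ≃ βΓ' :=
    ((M.outputAlphabet.trans (Equiv.ofInjective h hinj)).sumCongr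
      (Equiv.subtypeUnivEquiv fun _ => rfl)).trans (Equiv.Set.sumCompl (Set.range h))
  let _ := M.tm.Γk₀Fin
  let tm' : Turing.FinTM2 :=
    { K := M.tm.K
      kDecidableEq := M.tm.kDecidableEq
      kFin := M.tm.kFin
      k₀ := M.tm.k₀
      k₁ := M.tm.k₁
      Γ := ExtendedAlphabet M.tm.Γ M.tm.k₁ E
      Λ := M.tm.Λ
      main := M.tm.main
      ΛFin := M.tm.ΛFin
      σ := M.tm.σ
      initialState := M.tm.initialState
      σFin := M.tm.σFin
      Γk₀Fin := Fintype.ofEquiv _ hin.symm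
      m := fun l => extendAlphabet M.tm.k₁ E (M.tm.m l) }
  refine ⟨⟨⟨tm', hin.trans M.inputAlphabet, hout⟩, M.time, fun a => ?_⟩⟩
  have hout' (x : βΓ) : hout.symm (h x) = Sum.inl (M.outputAlphabet.symm x) := by
    rw [Equiv.symm_apply_eq]
    simp [hout, E]
  refine evalsToInTimeMap (extendCfg M.tm.k₁ E)
    (step_extendAlphabet M.tm.k₁ E M.tm.m) (M.outputsFun a) ?_ ?_
  · simp only [Turing.initList, extendCfg]
    congr 1
    funext k
    by_cases hk : k = M.tm.k₀
    · subst hk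
      simp [tm']
      intro b _
      rfl
    · simp [hk, tm']
  · rw [hmap]
    simp only [Option.map_some, Turing.haltList]
    congr 2
    funext k
    by_cases hk : k = M.tm.k₁
    · subst hk
      simp [tm', hout']
    · simp [hk, tm']

/-! ### The encoding of a qubit into four modes -/

/-- The occupation numbers of the four modes of a block. The logical qubit is the negation of
mode 2; the other degrees of freedom are the modes 0 and 1 and the parity of the modes 2 and 3. -/
def blockEquiv : (Fin 4 → Bool) ≃ Bool × Bool × Bool × Bool where
  -- The negation is due to `i X Y = -Z` on mode 2. The parity of modes 2 and 3 is a gauge degree of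
  -- freedom because products of two of their Majorana operators preserve it.
  toFun s := (!s 2, s 0, s 1, xor (s 2) (s 3))
  invFun u := ![u.2.1, u.2.2.1, !u.1, xor (!u.1) u.2.2.2]
  left_inv := by decide
  right_inv := by decide

/-- The state of the degrees of freedom other than the logical qubits. -/
abbrev Gauge (p : ℕ) : Type := Fin p → Bool × Bool × Bool

/-- The block `i` of a basis state. -/
def block {p : ℕ} (s : Fin (p * 4) → Bool) (i : Fin p) : Fin 4 → Bool :=
  fun k => s (finProdFinEquiv (i, k))

/-- The separation of the logical qubits of `p` blocks from the other degrees of freedom. -/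
def registerEquiv (p : ℕ) : (Fin (p * 4) → Bool) ≃ (Fin p → Bool) × Gauge p :=
  (((finProdFinEquiv.symm.arrowCongr (Equiv.refl Bool)).trans (Equiv.curry _ _ _)).trans
    (Equiv.piCongrRight fun _ => blockEquiv)).trans (Equiv.arrowProdEquivProdArrow _ _ _)

theorem registerEquiv_apply {p : ℕ} (s : Fin (p * 4) → Bool) :
    registerEquiv p s =
      (fun i => (blockEquiv (block s i)).1, fun i => (blockEquiv (block s i)).2) :=
  rfl

/-- The operator on `p * 4` modes that acts on the logical qubits as `A`. -/
noncomputable def encodeOp {p : ℕ} (A : Op p) : Op (p * 4) :=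
  (A ⊗ₖ (1 : Matrix (Gauge p) (Gauge p) ℂ)).submatrix (registerEquiv p) (registerEquiv p)

theorem encodeOp_one (p : ℕ) : encodeOp (1 : Op p) = 1 := by
  simp [encodeOp]

theorem encodeOp_mul {p : ℕ} (A B : Op p) : encodeOp (A * B) = encodeOp A * encodeOp B := by
  rw [encodeOp, encodeOp, encodeOp, Matrix.submatrix_mul_equiv, ← Matrix.mul_kronecker_mul,
    one_mul]

theorem encodeOp_list_prod {p : ℕ} (l : List (Op p)) :
    encodeOp l.prod = (l.map encodeOp).prod := by
  induction l with
  | nil => exact encodeOp_one p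
  | cons A l ih => rw [List.prod_cons, encodeOp_mul, ih, List.map_cons, List.prod_cons]

/-- The qubit state of the logical qubits. -/
noncomputable def decodeState {p : ℕ} (ρ : Op (p * 4)) : Op p :=
  ∑ g : Gauge p, ρ.submatrix (fun s => (registerEquiv p).symm (s, g))
    (fun s => (registerEquiv p).symm (s, g))

theorem isDensity_decodeState {p : ℕ} {ρ : Op (p * 4)} (hρ : IsDensity ρ) :
    IsDensity (decodeState ρ) := by
  refine ⟨Matrix.posSemidef_sum _ fun g _ => hρ.1.submatrix _, ?_⟩
  rw [← hρ.2, decodeState, Matrix.trace_sum]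
  simp only [Matrix.trace, Matrix.diag_apply, Matrix.submatrix_apply]
  rw [Finset.sum_comm, ← Fintype.sum_prod_type', ← (registerEquiv p).symm.sum_comp]

/-- The encoding of a qubit state, with all other degrees of freedom in the state `0`. -/
noncomputable def encodeState {p : ℕ} (ρ : Op p) : Op (p * 4) :=
  (ρ ⊗ₖ Matrix.single (fun _ => (false, false, false)) (fun _ => (false, false, false))
    (1 : ℂ)).submatrix (registerEquiv p) (registerEquiv p)

theorem decodeState_encodeState {p : ℕ} (ρ : Op p) : decodeState (encodeState ρ) = ρ := by
  ext s t
  simp [decodeState, encodeState, Matrix.sum_apply, Matrix.single_apply, Matrix.kroneckerMap_apply]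

theorem posSemidef_single {ι : Type} [Fintype ι] [DecidableEq ι] (i : ι) :
    (Matrix.single i i (1 : ℂ)).PosSemidef := by
  rw [← Matrix.diagonal_single]
  refine Matrix.PosSemidef.diagonal fun j => ?_
  by_cases h : j = i
  · subst h; simp
  · simp [h]

theorem isDensity_encodeState {p : ℕ} {ρ : Op p} (hρ : IsDensity ρ) :
    IsDensity (encodeState ρ) := by
  refine ⟨(hρ.1.kronecker (posSemidef_single _)).submatrix _, ?_⟩
  have h : (encodeState ρ).trace = (ρ ⊗ₖ Matrix.single
      (fun _ : Fin p => (false, false, false)) (fun _ => (false, false, false)) (1 : ℂ)).trace :=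
    (registerEquiv p).sum_comp fun x => (ρ ⊗ₖ Matrix.single
      (fun _ : Fin p => (false, false, false)) (fun _ => (false, false, false)) (1 : ℂ)) x x
  rw [h, Matrix.trace_kronecker, hρ.2, Matrix.trace_single_eq_same, one_mul]

theorem prod_registerBlocks {M : Type} [CommMonoid M] {p : ℕ} (f : Fin (p * 4) → M) :
    ∏ k, f k = ∏ i : Fin p, ∏ k : Fin 4, f (finProdFinEquiv (i, k)) := by
  rw [← finProdFinEquiv.prod_comp, Fintype.prod_prod_type]

theorem parity_eq_diagonal (n : ℕ) :
    parity n = Matrix.diagonal fun s => ∏ k, if s k then (-1 : ℂ) else 1 := by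
  ext s t
  rw [Matrix.diagonal_apply]
  split_ifs with h
  · subst h
    simp [parity, pauliString, tensor, Pauli.toMatrix]
  · obtain ⟨k, hk⟩ := Function.ne_iff.1 h
    exact Finset.prod_eq_zero (Finset.mem_univ k) (by simp [Pauli.toMatrix, hk])

/-- The parity of a block is a function of its gauge part alone, and entries of the encoded state
between different gauge parts vanish. -/
theorem commute_parity_encodeState {p : ℕ} (ρ : Op p) :
    Commute (parity (p * 4)) (encodeState ρ) := by
  ext s t
  rw [parity_eq_diagonal, Matrix.diagonal_mul, Matrix.mul_diagonal, mul_comm]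
  by_cases h : (registerEquiv p s).2 = (registerEquiv p t).2
  · congr 1
    rw [prod_registerBlocks, prod_registerBlocks]
    refine Finset.prod_congr rfl fun i _ => ?_
    have hi : (blockEquiv (block s i)).2 = (blockEquiv (block t i)).2 := congrFun h i
    change (∏ k, if block s i k then (-1 : ℂ) else 1) = ∏ k, if block t i k then (-1 : ℂ) else 1
    generalize block s i = a at hi
    generalize block t i = b at hi
    simp only [blockEquiv, Equiv.coe_fn_mk, Prod.mk.injEq] at hi
    obtain ⟨h0, h1, h2⟩ := hi
    simp only [Fin.prod_univ_four, h0, h1]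
    revert h2
    cases a 2 <;> cases a 3 <;> cases b 2 <;> cases b 3 <;> simp
  · have h0 : encodeState ρ s t = 0 := by
      simp only [encodeState, Matrix.submatrix_apply, Matrix.kroneckerMap_apply]
      rw [Matrix.single_apply, if_neg, mul_zero]
      rintro ⟨h₁, h₂⟩
      exact h (h₁.symm.trans h₂)
    rw [h0, zero_mul, zero_mul]

theorem isFermionicState_encodeState {p : ℕ} {ρ : Op p} (hρ : IsDensity ρ) :
    IsFermionicState (encodeState ρ) :=
  ⟨isDensity_encodeState hρ, commute_parity_encodeState ρ⟩

/-! ### Encoded circuits -/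

/-- The separation of the logical qubits and the ancillas from the other degrees of freedom. -/
def circuitEquiv (p a : ℕ) :
    ((Fin (p * 4) → Bool) × (Fin a → Bool)) ≃ ((Fin p → Bool) × (Fin a → Bool)) × Gauge p where
  toFun s := (((registerEquiv p s.1).1, s.2), (registerEquiv p s.1).2)
  invFun u := ((registerEquiv p).symm (u.1.1, u.2), u.1.2)
  left_inv s := by simp
  right_inv u := by simp

/-- The operator on `p * 4` modes and `a` ancillas that acts on the logical qubits and the
ancillas as `A`. -/
noncomputable def encodeCircuitOp {p a : ℕ}
    (A : Matrix ((Fin p → Bool) × (Fin a → Bool)) ((Fin p → Bool) × (Fin a → Bool)) ℂ) :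
    Matrix ((Fin (p * 4) → Bool) × (Fin a → Bool)) ((Fin (p * 4) → Bool) × (Fin a → Bool)) ℂ :=
  (A ⊗ₖ (1 : Matrix (Gauge p) (Gauge p) ℂ)).submatrix (circuitEquiv p a) (circuitEquiv p a)

theorem encodeCircuitOp_one (p a : ℕ) : encodeCircuitOp (p := p) (a := a) 1 = 1 := by
  simp [encodeCircuitOp]

theorem encodeCircuitOp_mul {p a : ℕ}
    (A B : Matrix ((Fin p → Bool) × (Fin a → Bool)) ((Fin p → Bool) × (Fin a → Bool)) ℂ) :
    encodeCircuitOp (A * B) = encodeCircuitOp A * encodeCircuitOp B := by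
  rw [encodeCircuitOp, encodeCircuitOp, encodeCircuitOp, Matrix.submatrix_mul_equiv,
    ← Matrix.mul_kronecker_mul, one_mul]

theorem encodeCircuitOp_add {p a : ℕ}
    (A B : Matrix ((Fin p → Bool) × (Fin a → Bool)) ((Fin p → Bool) × (Fin a → Bool)) ℂ) :
    encodeCircuitOp (A + B) = encodeCircuitOp A + encodeCircuitOp B := by
  rw [encodeCircuitOp, Matrix.add_kronecker]
  rfl

theorem encodeCircuitOp_smul {p a : ℕ} (z : ℂ)
    (A : Matrix ((Fin p → Bool) × (Fin a → Bool)) ((Fin p → Bool) × (Fin a → Bool)) ℂ) :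
    encodeCircuitOp (z • A) = z • encodeCircuitOp A := by
  rw [encodeCircuitOp, Matrix.smul_kronecker]
  rfl

theorem encodeCircuitOp_conjTranspose {p a : ℕ}
    (A : Matrix ((Fin p → Bool) × (Fin a → Bool)) ((Fin p → Bool) × (Fin a → Bool)) ℂ) :
    (encodeCircuitOp A).conjTranspose = encodeCircuitOp A.conjTranspose := by
  rw [encodeCircuitOp, Matrix.conjTranspose_submatrix, Matrix.conjTranspose_kronecker,
    Matrix.conjTranspose_one]
  rfl

theorem encodeCircuitOp_kronecker {p a : ℕ} (A : Op p) (B : Op a) :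
    encodeCircuitOp (A ⊗ₖ B) = encodeOp A ⊗ₖ B := by
  ext s t
  simp only [encodeCircuitOp, encodeOp, circuitEquiv, Matrix.submatrix_apply,
    Matrix.kroneckerMap_apply, Equiv.coe_fn_mk]
  ring

theorem encodeCircuitOp_acceptProj (p a : ℕ) :
    encodeCircuitOp (acceptProj p a) = acceptProj (p * 4) a := by
  rw [encodeCircuitOp, acceptProj, ← Matrix.diagonal_one, Matrix.diagonal_kronecker_diagonal,
    Matrix.submatrix_diagonal_equiv]
  simp [acceptProj, circuitEquiv, Function.comp_def]

/-- Partial trace is dual to tensoring with the identity; this is what makes every fermionic proof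
equivalent to a qubit proof. -/
theorem trace_encodeCircuitOp_mul {p a : ℕ}
    (A : Matrix ((Fin p → Bool) × (Fin a → Bool)) ((Fin p → Bool) × (Fin a → Bool)) ℂ)
    (ρ : Op (p * 4)) (τ : Op a) :
    (encodeCircuitOp A * (ρ ⊗ₖ τ)).trace = (A * (decodeState ρ ⊗ₖ τ)).trace := by
  have h (x : (Fin p → Bool) × (Fin a → Bool)) (g : Gauge p) :
      (encodeCircuitOp A * (ρ ⊗ₖ τ)) ((circuitEquiv p a).symm (x, g))
        ((circuitEquiv p a).symm (x, g)) =
      ∑ y, A x y * (ρ ((registerEquiv p).symm (y.1, g)) ((registerEquiv p).symm (x.1, g)) *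
        τ y.2 x.2) := by
    rw [Matrix.mul_apply, ← (circuitEquiv p a).symm.sum_comp, Fintype.sum_prod_type]
    refine Finset.sum_congr rfl fun y _ => ?_
    simp only [encodeCircuitOp, Matrix.submatrix_apply, Equiv.apply_symm_apply,
      Matrix.kroneckerMap_apply, Matrix.one_apply, mul_ite, ite_mul, mul_one, mul_zero, zero_mul,
      Finset.sum_ite_eq, Finset.mem_univ, if_true]
    rfl
  simp only [Matrix.trace, Matrix.diag_apply]
  rw [← (circuitEquiv p a).symm.sum_comp, Fintype.sum_prod_type]
  refine Finset.sum_congr rfl fun x _ => ?_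
  simp only [h, Matrix.mul_apply, Matrix.kroneckerMap_apply, decodeState, Matrix.sum_apply,
    Matrix.submatrix_apply, Finset.sum_mul, Finset.mul_sum]
  exact Finset.sum_comm

/-- The gate `g` with another action on the proof. -/
def Gate.mapLabel {G H : Type} (θ : G → H) (g : Gate G) : Gate H :=
  ⟨g.neg, θ g.onProof, g.pauli₁, g.pauli₂, g.anc₁, g.anc₂⟩

/-- A gate is a combination of `1` and its Hermitian operator, and `encodeCircuitOp` is linear,
unital and multiplicative; hence each gate is simulated by a single gate. -/
theorem circuitOp_map_mapLabel {G H : Type} {p : ℕ} {L : G → Op p} {L' : H → Op (p * 4)}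
    {θ : G → H} (hL : ∀ l, L' (θ l) = encodeOp (L l)) (a : ℕ) (c : List (Gate G)) :
    circuitOp L' a (c.map (Gate.mapLabel θ)) = encodeCircuitOp (circuitOp L a c) := by
  induction c with
  | nil => exact (encodeCircuitOp_one p a).symm
  | cons g c ih =>
    have hg : (g.mapLabel θ).op L' a = encodeCircuitOp (g.op L a) := by
      rw [Gate.op, Gate.op, encodeCircuitOp_add, encodeCircuitOp_smul, encodeCircuitOp_smul,
        encodeCircuitOp_one, encodeCircuitOp_kronecker, ← hL]
      rfl
    rw [List.map_cons, circuitOp, circuitOp, ih, encodeCircuitOp_mul, hg]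

theorem circuitAccept_map_mapLabel {G H : Type} {p : ℕ} {L : G → Op p} {L' : H → Op (p * 4)}
    {θ : G → H} (hL : ∀ l, L' (θ l) = encodeOp (L l)) (a : ℕ) (c : List (Gate G))
    (ρ : Op (p * 4)) :
    circuitAccept L' a (c.map (Gate.mapLabel θ)) ρ = circuitAccept L a c (decodeState ρ) := by
  unfold circuitAccept
  -- By cyclicity of the trace, the circuit and the projector are gathered into one encoded
  -- observable `U† Π U`, tested against the initial state.
  rw [circuitOp_map_mapLabel hL, ← encodeCircuitOp_acceptProj, encodeCircuitOp_conjTranspose,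
    ← mul_assoc, Matrix.trace_mul_comm, ← mul_assoc, ← mul_assoc, ← encodeCircuitOp_mul,
    ← encodeCircuitOp_mul, trace_encodeCircuitOp_mul, mul_assoc, mul_assoc,
    Matrix.trace_mul_comm, mul_assoc, mul_assoc]

/-! ### Products of Pauli strings -/

theorem tensor_mul {n : ℕ} (A B : Fin n → Matrix Bool Bool ℂ) :
    tensor A * tensor B = tensor fun k => A k * B k := by
  ext s t
  simp only [tensor, Matrix.mul_apply, Matrix.of_apply, ← Finset.prod_mul_distrib]
  rw [Finset.prod_univ_sum, Fintype.piFinset_univ]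

theorem tensor_one (n : ℕ) : tensor (fun _ : Fin n => (1 : Matrix Bool Bool ℂ)) = 1 := by
  ext s t
  simp only [tensor, Matrix.of_apply, Matrix.one_apply, Finset.prod_ite_zero, Finset.prod_const_one,
    Finset.mem_univ, true_implies, funext_iff]

theorem tensor_list_prod {n : ℕ} {ι : Type} (l : List ι) (A : ι → Fin n → Matrix Bool Bool ℂ) :
    (l.map fun i => tensor (A i)).prod = tensor fun k => (l.map fun i => A i k).prod := by
  induction l with
  | nil => exact (tensor_one n).symm
  | cons i l ih => simp only [List.map_cons, List.prod_cons, ih, tensor_mul]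

/-- The Pauli matrix `P` on qubit `j`. -/
noncomputable def pauliAt (p j : ℕ) (P : Pauli) : Op p :=
  pauliString fun k : Fin p => if (k : ℕ) = j then P else Pauli.I

theorem pauliAt_I (p j : ℕ) : pauliAt p j Pauli.I = 1 := by
  rw [← tensor_one]
  simp [pauliAt, pauliString, Pauli.toMatrix]

theorem list_prod_map_eq_of_nodup {M ι : Type} [Monoid M] {l : List ι} (hl : l.Nodup) {i : ι}
    (hi : i ∈ l) {f : ι → M} (hf : ∀ j, j ≠ i → f j = 1) : (l.map f).prod = f i := by
  obtain ⟨l₁, l₂, rfl⟩ := List.append_of_mem hi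
  have h := (List.nodup_middle.1 hl)
  rw [List.nodup_cons, List.mem_append, not_or] at h
  have h₁ : (l₁.map f).prod = 1 := List.prod_eq_one fun x hx => by
    obtain ⟨j, hj, rfl⟩ := List.mem_map.1 hx
    exact hf j fun e => h.1.1 (e ▸ hj)
  have h₂ : (l₂.map f).prod = 1 := List.prod_eq_one fun x hx => by
    obtain ⟨j, hj, rfl⟩ := List.mem_map.1 hx
    exact hf j fun e => h.1.2 (e ▸ hj)
  rw [List.map_append, List.prod_append, List.map_cons, List.prod_cons, h₁, h₂, one_mul, mul_one]

theorem qubitLabelOp_eq_prod {q : ℕ} (p : ℕ) {pos : Fin q → ℕ} (hpos : Function.Injective pos)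
    (P : QubitLabel q) :
    qubitLabelOp p pos P = ((List.finRange q).map fun i => pauliAt p (pos i) (P i)).prod := by
  unfold pauliAt pauliString qubitLabelOp pauliString
  rw [tensor_list_prod]
  congr 1
  funext k
  dsimp only
  by_cases h : ∃ i, pos i = k
  · obtain ⟨i, hi⟩ := h
    rw [← hi, hpos.extend_apply, list_prod_map_eq_of_nodup (List.nodup_finRange q)
      (List.mem_finRange i), if_pos rfl]
    intro j hj
    rw [if_neg fun e => hj (hpos e.symm)]
    rfl
  · rw [Function.extend_apply' _ _ _ h]
    refine (List.prod_eq_one fun x hx => ?_).symm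
    obtain ⟨i, -, rfl⟩ := List.mem_map.1 hx
    rw [if_neg fun e => h ⟨i, e.symm⟩]
    rfl

/-! ### The logical Pauli operators -/

/-- The two Majorana operators, among those of the modes 3 and 2 of a block, whose product is, up
to a phase, a logical Pauli operator. -/
def pauliMajoranas : Pauli → Finset (Fin 2 × Fin 2)
  | Pauli.I => ∅
  | Pauli.X => {(0, 0), (1, 1)}
  | Pauli.Y => {(0, 0), (1, 0)}
  | Pauli.Z => {(1, 0), (1, 1)}

theorem pauliMajoranas_injective : Function.Injective pauliMajoranas := by decide

theorem encodeOp_pauliAt_apply {p j : ℕ} (P : Pauli) (s t : Fin (p * 4) → Bool) :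
    encodeOp (pauliAt p j P) s t = ∏ i : Fin p,
      ((if (i : ℕ) = j then P else Pauli.I).toMatrix
        (blockEquiv (block s i)).1 (blockEquiv (block t i)).1 *
        if (blockEquiv (block s i)).2 = (blockEquiv (block t i)).2 then 1 else 0) := by
  simp only [encodeOp, Matrix.submatrix_apply, Matrix.kroneckerMap_apply, registerEquiv_apply,
    pauliAt, pauliString, tensor, Matrix.of_apply, Finset.prod_mul_distrib, Matrix.one_apply,
    Finset.prod_ite_zero, Finset.prod_const_one, Finset.mem_univ, true_implies, funext_iff]

theorem pauli_Z_mul_Z : Pauli.Z.toMatrix * Pauli.Z.toMatrix = 1 := by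
  ext s t
  cases s <;> cases t <;> simp [Pauli.toMatrix, Matrix.mul_apply]

theorem prod_one_apply_eq_blockEquiv (s t : Fin 4 → Bool) :
    ∏ k, (1 : Matrix Bool Bool ℂ) (s k) (t k) =
      (1 : Matrix Bool Bool ℂ) (blockEquiv s).1 (blockEquiv t).1 *
        if (blockEquiv s).2 = (blockEquiv t).2 then 1 else 0 := by
  have h : (∀ k, s k = t k) ↔ (blockEquiv s).1 = (blockEquiv t).1 ∧
      (blockEquiv s).2 = (blockEquiv t).2 := by
    rw [← Prod.ext_iff, blockEquiv.injective.eq_iff, funext_iff]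
  simp only [Matrix.one_apply, Finset.prod_ite_zero, Finset.prod_const_one, Finset.mem_univ,
    true_implies, h, ite_and, mul_ite, mul_one, mul_zero]
  split_ifs <;> rfl

/-- The Pauli matrix of a Majorana operator of the mode `m` on the mode `k`. -/
def majoranaPauli (m k : ℕ) (u : Fin 2) : Pauli :=
  if k < m then Pauli.Z else if k = m then (if u = 0 then Pauli.X else Pauli.Y) else Pauli.I

/-- Reduces a logical Pauli operator to an identity on one block: on earlier blocks the two strings
give `Z * Z = 1`, on later blocks both factors are `1`. -/
theorem smul_majorana_mul_majorana_eq_encodeOp {p j : ℕ} (hj : j < p) {m n : Fin 4} {u v : Fin 2}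
    {P : Pauli}
    (h : ∀ s t : Fin 4 → Bool, Complex.I * ∏ k : Fin 4,
        ((majoranaPauli m k u).toMatrix * (majoranaPauli n k v).toMatrix) (s k) (t k) =
      P.toMatrix (blockEquiv s).1 (blockEquiv t).1 *
        if (blockEquiv s).2 = (blockEquiv t).2 then 1 else 0) :
    Complex.I • (majorana (p * 4) (4 * j + m) u * majorana (p * 4) (4 * j + n) v) =
      encodeOp (pauliAt p j P) := by
  ext s t
  rw [encodeOp_pauliAt_apply]
  unfold majorana pauliString
  rw [tensor_mul, Matrix.smul_apply, tensor, Matrix.of_apply, prod_registerBlocks, smul_eq_mul]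
  -- The global phase is assigned to block `j`, so that the two sides can be compared block by
  -- block.
  have hI : Complex.I = ∏ i : Fin p, if (i : ℕ) = j then Complex.I else 1 := by
    rw [Finset.prod_eq_single (⟨j, hj⟩ : Fin p)]
    · simp
    · intro i _ hi
      rw [if_neg fun e => hi (Fin.ext e)]
    · simp
  conv_lhs => rw [hI]
  rw [← Finset.prod_mul_distrib]
  refine Finset.prod_congr rfl fun i _ => ?_
  have hlabel (m : Fin 4) (u : Fin 2) (k : Fin 4) :
      majoranaPauli (4 * j + m) (finProdFinEquiv (i, k)) u =
        if (i : ℕ) = j then majoranaPauli m k u else if (i : ℕ) < j then Pauli.Z else Pauli.I := by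
    have hk : ((finProdFinEquiv (i, k) : Fin (p * 4)) : ℕ) = k + 4 * i := rfl
    unfold majoranaPauli
    rw [hk]
    split_ifs <;> first | rfl | omega
  change _ * ∏ k, ((majoranaPauli (4 * j + m) (finProdFinEquiv (i, k)) u).toMatrix *
    (majoranaPauli (4 * j + n) (finProdFinEquiv (i, k)) v).toMatrix) (block s i k) (block t i k) = _
  simp only [hlabel]
  by_cases hi : (i : ℕ) = j
  · simp only [if_pos hi]
    exact h _ _
  · simp only [if_neg hi, one_mul]
    refine Eq.trans (Finset.prod_congr rfl fun k _ => ?_) (prod_one_apply_eq_blockEquiv _ _)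
    split_ifs
    · rw [pauli_Z_mul_Z]
    · rw [Pauli.toMatrix, one_mul]

theorem encodeOp_pauliAt_X {p j : ℕ} (hj : j < p) :
    Complex.I • (majorana (p * 4) (4 * j + 3) 0 * majorana (p * 4) (4 * j + 2) 1) =
      encodeOp (pauliAt p j Pauli.X) := by
  refine smul_majorana_mul_majorana_eq_encodeOp (m := 3) (n := 2) hj fun s t => ?_
  simp only [Fin.prod_univ_four, majoranaPauli, blockEquiv, Equiv.coe_fn_mk, Prod.mk.injEq]
  generalize s 0 = s₀, t 0 = t₀, s 1 = s₁, t 1 = t₁, s 2 = s₂, t 2 = t₂, s 3 = s₃, t 3 = t₃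
  -- On modes 0 and 1 both operators act as `Z`, so the product is the identity there; the rest is a
  -- check on modes 2 and 3.
  by_cases h₀ : s₀ = t₀ <;> by_cases h₁ : s₁ = t₁ <;>
    simp [h₀, h₁, Pauli.toMatrix, Matrix.mul_apply, Matrix.one_apply]
  cases s₂ <;> cases t₂ <;> cases s₃ <;> cases t₃ <;> simp <;>
    cases t₀ <;> cases t₁ <;> simp

theorem encodeOp_pauliAt_Y {p j : ℕ} (hj : j < p) :
    Complex.I • (majorana (p * 4) (4 * j + 3) 0 * majorana (p * 4) (4 * j + 2) 0) =
      encodeOp (pauliAt p j Pauli.Y) := by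
  refine smul_majorana_mul_majorana_eq_encodeOp (m := 3) (n := 2) hj fun s t => ?_
  simp only [Fin.prod_univ_four, majoranaPauli, blockEquiv, Equiv.coe_fn_mk, Prod.mk.injEq]
  generalize s 0 = s₀, t 0 = t₀, s 1 = s₁, t 1 = t₁, s 2 = s₂, t 2 = t₂, s 3 = s₃, t 3 = t₃
  by_cases h₀ : s₀ = t₀ <;> by_cases h₁ : s₁ = t₁ <;>
    simp [h₀, h₁, Pauli.toMatrix, Matrix.mul_apply, Matrix.one_apply]
  cases s₂ <;> cases t₂ <;> cases s₃ <;> cases t₃ <;> simp <;>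
    cases t₀ <;> cases t₁ <;> simp

theorem encodeOp_pauliAt_Z {p j : ℕ} (hj : j < p) :
    Complex.I • (majorana (p * 4) (4 * j + 2) 0 * majorana (p * 4) (4 * j + 2) 1) =
      encodeOp (pauliAt p j Pauli.Z) := by
  refine smul_majorana_mul_majorana_eq_encodeOp (m := 2) (n := 2) hj fun s t => ?_
  simp only [Fin.prod_univ_four, majoranaPauli, blockEquiv, Equiv.coe_fn_mk, Prod.mk.injEq]
  generalize s 0 = s₀, t 0 = t₀, s 1 = s₁, t 1 = t₁, s 2 = s₂, t 2 = t₂, s 3 = s₃, t 3 = t₃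
  by_cases h₀ : s₀ = t₀ <;> by_cases h₁ : s₁ = t₁ <;>
    simp [h₀, h₁, Pauli.toMatrix, Matrix.mul_apply, Matrix.one_apply]
  cases s₂ <;> cases t₂ <;> cases s₃ <;> cases t₃ <;> simp <;>
    cases t₀ <;> cases t₁ <;> simp

/-! ### Encoded labels -/

/-- The Majorana operators for the Pauli matrices `P` on the logical qubits. -/
def encodeLabel {q : ℕ} (P : QubitLabel q) : FermionLabel (q * 2) :=
  Finset.univ.filter fun k => (k.divNat.modNat, k.modNat) ∈ pauliMajoranas (P k.divNat.divNat)

/-- The modes 3 and 2 of the accessed blocks. -/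
def encodePosition {q : ℕ} (pos : Fin q → ℕ) (k : Fin (q * 2)) : ℕ :=
  -- Mode 3 is listed before mode 2, so that the ordered product in `fermionLabelOp` has the order
  -- of the factors of the logical `X` and `Y`.
  4 * pos k.divNat + if k.modNat = 0 then 3 else 2

theorem mem_encodeLabel {q : ℕ} (P : QubitLabel q) (i : Fin q) (l s : Fin 2) :
    finProdFinEquiv (finProdFinEquiv (i, l), s) ∈ encodeLabel P ↔ (l, s) ∈ pauliMajoranas (P i) := by
  have h (n : ℕ) (x : Fin n × Fin 2) :
      (finProdFinEquiv x).divNat = x.1 ∧ (finProdFinEquiv x).modNat = x.2 :=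
    Prod.ext_iff.1 (finProdFinEquiv.symm_apply_apply x)
  rw [encodeLabel, Finset.mem_filter, (h _ _).1, (h _ _).2, (h _ _).1, (h _ _).2]
  simp

theorem encodeLabel_injective (q : ℕ) : Function.Injective (encodeLabel (q := q)) := by
  intro P Q h
  funext i
  refine pauliMajoranas_injective (Finset.ext fun x => ?_)
  rw [← mem_encodeLabel P i x.1 x.2, h, mem_encodeLabel]

theorem card_pauliMajoranas (P : Pauli) :
    (pauliMajoranas P).card = 2 * if P ≠ Pauli.I then 1 else 0 := by
  cases P <;> rfl

theorem card_encodeLabel {q : ℕ} (P : QubitLabel q) :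
    (encodeLabel P).card = 2 * (Finset.univ.filter fun i => P i ≠ Pauli.I).card := by
  classical
  have h : (encodeLabel P).card = ∑ k, if k ∈ encodeLabel P then 1 else 0 := by simp
  rw [h, ← finProdFinEquiv.sum_comp, Fintype.sum_prod_type, ← finProdFinEquiv.sum_comp,
    Fintype.sum_prod_type, Finset.card_filter, Finset.mul_sum]
  refine Finset.sum_congr rfl fun i _ => ?_
  simp only [mem_encodeLabel, ← card_pauliMajoranas]
  rw [← Fintype.sum_prod_type' fun l s => if (l, s) ∈ pauliMajoranas (P i) then 1 else 0]
  simp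

theorem list_finRange_mul_prod {M : Type} [Monoid M] (m n : ℕ) (f : Fin (m * n) → M) :
    ((List.finRange (m * n)).map f).prod =
      ((List.finRange m).map fun i =>
        ((List.finRange n).map fun j => f (finProdFinEquiv (i, j))).prod).prod := by
  simp only [← List.ofFn_eq_map]
  rw [List.ofFn_mul, List.prod_flatten, List.map_ofFn]
  congr 2
  funext i
  simp only [Function.comp_apply]
  congr 2
  funext j
  congr 1
  ext
  simp [finProdFinEquiv]
  ring

theorem list_prod_map_smul {n ι : Type} [Fintype n] [DecidableEq n] (l : List ι) (z : ι → ℂ)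
    (A : ι → Matrix n n ℂ) :
    (l.map fun i => z i • A i).prod = (l.map z).prod • (l.map A).prod := by
  induction l with
  | nil => simp
  | cons i l ih => simp only [List.map_cons, List.prod_cons, ih, smul_mul_smul_comm]

/-- The exponent is `m + 2m(m - 1)`, and `m(m - 1)` is even. Thus the phase of a Majorana product of
size `2m` is one factor `i` for each logical Pauli matrix. -/
theorem I_pow_two_mul (m : ℕ) : Complex.I ^ (2 * m * (2 * m - 1) / 2) = Complex.I ^ m := by
  have h : 2 * m * (2 * m - 1) / 2 = m + 4 * (m * (m - 1) / 2) := by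
    rw [mul_assoc, Nat.mul_div_cancel_left _ two_pos]
    obtain ⟨k, hk⟩ := (Nat.even_mul_pred_self m).two_dvd
    rw [hk, Nat.mul_div_cancel_left _ two_pos]
    cases m with
    | zero => simp at hk; omega
    | succ m =>
      simp only [Nat.add_sub_cancel] at hk
      rw [show 2 * (m + 1) - 1 = 2 * m + 1 by omega]
      nlinarith
  rw [h, pow_add, pow_mul, Complex.I_pow_four, one_pow, mul_one]

theorem fermionLabelOp_encodeLabel {q p : ℕ} {pos : Fin q → ℕ} (hpos : Function.Injective pos)
    (hp : ∀ i, pos i < p) (P : QubitLabel q) :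
    fermionLabelOp (p * 4) (encodePosition pos) (encodeLabel P) =
      encodeOp (qubitLabelOp p pos P) := by
  have h (n : ℕ) (x : Fin n × Fin 2) :
      (finProdFinEquiv x).divNat = x.1 ∧ (finProdFinEquiv x).modNat = x.2 :=
    Prod.ext_iff.1 (finProdFinEquiv.symm_apply_apply x)
  have hI : Complex.I ^ (Finset.univ.filter fun i => P i ≠ Pauli.I).card =
      ((List.finRange q).map fun i => if P i ≠ Pauli.I then Complex.I else 1).prod := by
    rw [← List.ofFn_eq_map, List.prod_ofFn, Finset.prod_ite, Finset.prod_const,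
      Finset.prod_const_one, mul_one]
  -- The ordered product is split by qubit, mode and Majorana operator, and each nontrivial qubit
  -- receives its own factor `i`.
  rw [fermionLabelOp, card_encodeLabel, I_pow_two_mul, hI, list_finRange_mul_prod,
    list_finRange_mul_prod, ← list_prod_map_smul, qubitLabelOp_eq_prod p hpos, encodeOp_list_prod,
    List.map_map]
  congr 2
  funext i
  simp only [Function.comp_apply, mem_encodeLabel, (h _ _).1, (h _ _).2, encodePosition]
  cases hP : P i
  · simp [pauliMajoranas, pauliAt_I, encodeOp_one]
  · rw [← encodeOp_pauliAt_X (hp i)]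
    simp [pauliMajoranas, List.finRange_succ]
  · rw [← encodeOp_pauliAt_Y (hp i)]
    simp [pauliMajoranas, List.finRange_succ]
  · rw [← encodeOp_pauliAt_Z (hp i)]
    simp [pauliMajoranas, List.finRange_succ]

/-! ### The encoded verifier -/

/-- The action on symbols of a change of the labels of gates. -/
def mapSymbol {G H : Type} (θ : G → H) : GateSymbol G → GateSymbol H :=
  Sum.map (Prod.map id (Prod.map θ id)) id

theorem mapSymbol_injective {G H : Type} {θ : G → H} (hθ : Function.Injective θ) :
    Function.Injective (mapSymbol θ) :=
  (Function.injective_id.prodMap (hθ.prodMap Function.injective_id)).sumMap Function.injective_id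

theorem encodeCircuit_map_mapLabel {G H : Type} (θ : G → H) (c : List (Gate G)) :
    encodeCircuit (c.map (Gate.mapLabel θ)) = (encodeCircuit c).map (mapSymbol θ) := by
  induction c with
  | nil => rfl
  | cons g c ih =>
    unfold encodeCircuit at ih ⊢
    rw [List.map_cons, List.flatMap_cons, ih, List.flatMap_cons, List.map_append]
    simp [encodeGate, Gate.mapLabel, mapSymbol]

/-- The cardinalities are `4` and `32 * 4 ^ q + 2`. This puts input and output on different stacks
in `PolyTime.mapAlphabet`. -/
theorem isEmpty_inputAlphabet_equiv_gateSymbol (q : ℕ) :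
    IsEmpty (Bool ⊕ Bool ≃ GateSymbol (QubitLabel q)) := by
  refine ⟨fun e => ?_⟩
  have hP : Fintype.card Pauli = 4 := rfl
  have h := Fintype.card_congr e
  simp only [Fintype.card_sum, Fintype.card_prod, Fintype.card_bool, Fintype.card_fun,
    Fintype.card_fin, hP] at h
  have := Nat.one_le_pow q 4 (by norm_num)
  omega

theorem encodePosition_lt {q p : ℕ} {pos : Fin q → ℕ} (hp : ∀ i, pos i < p) (k : Fin (q * 2)) :
    encodePosition pos k < p * 4 := by
  have := hp k.divNat
  unfold encodePosition
  split_ifs <;> omega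

theorem encodePosition_injective {q : ℕ} {pos : Fin q → ℕ} (hpos : Function.Injective pos) :
    Function.Injective (encodePosition pos) := by
  intro k l h
  unfold encodePosition at h
  apply finProdFinEquiv.symm.injective
  refine Prod.ext (hpos ?_) ?_
  · change pos k.divNat = pos l.divNat
    split_ifs at h <;> omega
  · change k.modNat = l.modNat
    split_ifs at h <;> omega

theorem polyTime_encodePosition {α αΓ : Type} {ea : α → List αΓ} {q : ℕ} {pos : Fin q → α → ℕ}
    (h : ∀ i, PolyTime ea Computability.encodeNat (pos i)) (k : Fin (q * 2)) :
    PolyTime ea Computability.encodeNat fun a => encodePosition (fun i => pos i a) k := by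
  -- `4n + 3 = 2(2n + 1) + 1` and `4n + 2 = 2(2n + 1)`; the common part `2n + 1` is nonzero.
  have h₁ : PolyTime ea Computability.encodeNat fun a => 2 * pos k.divNat a + 1 :=
    (h k.divNat).cons true fun a => encodeNat_two_mul_add_one _
  by_cases hk : k.modNat = 0
  · refine h₁.cons true fun a => ?_
    rw [← encodeNat_two_mul_add_one]
    congr 1
    simp only [encodePosition, hk, if_true]
    ring
  · refine h₁.cons false fun a => ?_
    rw [← encodeNat_two_mul (Nat.add_one_ne_zero _)]
    congr 1
    simp only [encodePosition, hk, if_false]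
    ring

/-- Each Pauli matrix on a proof qubit costs two Majorana operators, so the weight bound `2` doubles
to `4`. -/
theorem isFermionGate_mapLabel {q : ℕ} {g : Gate (QubitLabel q)} (hg : IsQubitGate g) :
    IsFermionGate (g.mapLabel encodeLabel) := by
  have h : (g.mapLabel encodeLabel).onProof.card = _ := card_encodeLabel g.onProof
  have h' : (g.mapLabel encodeLabel).ancWeight = g.ancWeight := rfl
  unfold IsQubitGate at hg
  unfold IsFermionGate
  rw [h, h']
  exact ⟨even_two_mul _, by omega⟩

/-- The fermionic verifier that runs a qubit verifier on the logical qubits. -/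
noncomputable def QubitVerifier.toFermion {q : ℕ} (V : QubitVerifier q) :
    FermionVerifier (q * 2) where
  proofSize := V.proofSize * 4
  ancillas := V.ancillas
  randomBits := V.randomBits
  randomBits_poly := V.randomBits_poly
  position k xr := encodePosition (fun i => V.position i xr) k
  position_poly := polyTime_encodePosition V.position_poly
  position_lt x r hr k := by
    have h : (V.proofSize * 4).eval x.length = V.proofSize.eval x.length * 4 := by simp
    rw [h]
    exact encodePosition_lt (V.position_lt x r hr) k
  position_injective x r hr := encodePosition_injective (V.position_injective x r hr)
  circuit xr := (V.circuit xr).map (Gate.mapLabel encodeLabel)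
  circuit_poly := V.circuit_poly.mapAlphabet (isEmpty_inputAlphabet_equiv_gateSymbol q)
    (mapSymbol_injective (encodeLabel_injective q)) fun _ => encodeCircuit_map_mapLabel _ _
  circuit_isGate x r hr g hg := by
    obtain ⟨g₀, hg₀, rfl⟩ := List.mem_map.1 hg
    have h := V.circuit_isGate x r hr g₀ hg₀
    exact ⟨isFermionGate_mapLabel h.1, h.2⟩

theorem QubitVerifier.toFermion_proofSize_eval {q : ℕ} (V : QubitVerifier q) (n : ℕ) :
    V.toFermion.proofSize.eval n = V.proofSize.eval n * 4 := by
  simp [QubitVerifier.toFermion]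

/-- The encoded verifier accepts a fermionic state with the probability with which the qubit
verifier accepts the state of the logical qubits. -/
theorem QubitVerifier.sum_circuitAccept_toFermion {q : ℕ} (V : QubitVerifier q) (x : List Bool)
    (ρ : Op (V.proofSize.eval x.length * 4)) :
    (∑ r : Fin (V.randomBits x.length) → Bool,
      circuitAccept (fermionLabelOp (V.proofSize.eval x.length * 4)
        fun k => V.toFermion.position k (x, List.ofFn r))
        (V.ancillas.eval x.length) (V.toFermion.circuit (x, List.ofFn r)) ρ) /
      2 ^ V.randomBits x.length = V.acceptProb qubitLabelOp x (decodeState ρ) := by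
  unfold Verifier.acceptProb
  congr 1
  refine Finset.sum_congr rfl fun r _ => ?_
  have hr : (List.ofFn r).length = V.randomBits x.length := List.length_ofFn
  exact circuitAccept_map_mapLabel (fun P => fermionLabelOp_encodeLabel
    (V.position_injective x _ hr) (V.position_lt x _ hr) P) _ _ ρ

theorem QubitVerifier.exists_acceptProb_toFermion {q : ℕ} (V : QubitVerifier q) (x : List Bool)
    {ρ : Op (V.proofSize.eval x.length)} (hρ : IsDensity ρ) :
    ∃ ρ' : Op (V.toFermion.proofSize.eval x.length), IsFermionicState ρ' ∧
      V.toFermion.acceptProb fermionLabelOp x ρ' = V.acceptProb qubitLabelOp x ρ := by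
  have h (ρ : Op (V.proofSize.eval x.length * 4)) := V.sum_circuitAccept_toFermion x ρ
  unfold Verifier.acceptProb at h ⊢
  -- The sizes of the two registers agree only propositionally; the rewriting replaces the index in
  -- the type of the state.
  rw [V.toFermion_proofSize_eval x.length]
  exact ⟨encodeState ρ, isFermionicState_encodeState hρ,
    (h _).trans (by rw [decodeState_encodeState])⟩

theorem QubitVerifier.exists_acceptProb_eq_toFermion {q : ℕ} (V : QubitVerifier q)
    (x : List Bool) {ρ' : Op (V.toFermion.proofSize.eval x.length)} (hρ' : IsDensity ρ') :
    ∃ ρ : Op (V.proofSize.eval x.length), IsDensity ρ ∧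
      V.toFermion.acceptProb fermionLabelOp x ρ' = V.acceptProb qubitLabelOp x ρ := by
  have h (ρ : Op (V.proofSize.eval x.length * 4)) := V.sum_circuitAccept_toFermion x ρ
  unfold Verifier.acceptProb at h ⊢
  revert ρ'
  rw [V.toFermion_proofSize_eval x.length]
  exact fun {ρ'} hρ' => ⟨decodeState ρ', isDensity_decodeState hρ', h ρ'⟩

end FermionicPCP

theorem mainTheorem5 (R : Set (ℕ → ℕ)) :
    FermionicPCP.QPCPConst R ⊆ FermionicPCP.FermPCPConst R := by
  intro A hA
  obtain ⟨q, V, hR, hyes, hno⟩ := Set.mem_iUnion.1 hA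
  refine Set.mem_iUnion.2 ⟨q * 2, FermionicPCP.QubitVerifier.toFermion V, hR, fun x hx => ?_,
    fun x hx ρ' hρ' => ?_⟩
  · obtain ⟨ρ, hρ, hacc⟩ := hyes x hx
    obtain ⟨ρ', hρ', h⟩ := FermionicPCP.QubitVerifier.exists_acceptProb_toFermion V x hρ
    exact ⟨ρ', hρ', h ▸ hacc⟩
  · obtain ⟨ρ, hρ, h⟩ := FermionicPCP.QubitVerifier.exists_acceptProb_eq_toFermion V x hρ'.1
    exact h ▸ hno x hx ρ hρ
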